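/- Let $M$ be a connected smooth (Hausdorff, finite-dimensional) manifold without boundary, and let $\alpha$ be a contact form on $M$, i.e. $\dim M = 2n+1$ for some $n \ge 0$ and $\alpha$ is a smooth $1$-form such that $\alpha \wedge (d\alpha)^n$ vanishes at no point; let $\xi = \ker \alpha$ be the corresponding co-oriented contact structure. Let $G$ be a torus (a Lie group isomorphic to $(S^1)^k$ for some $k$) with Lie algebra $\mathfrak g$, acting smoothly and effectively on $M$ and preserving $\alpha$ (hence also $\xi$ and its co-orientation). For $A \in \mathfrak g$ let $A_M$ denote the vector field induced by $A$ on $M$, and let the moment map $\Psi_\alpha : M \to \mathfrak g^*$ be defined by $$\langle \Psi_\alpha(x), A\rangle = \alpha_x(A_M(x)), \qquad x \in M,\ A \in \mathfrak g.$$ If $\dim M + 1 = 2 \dim G$, then $\Psi_\alpha(x) \neq 0$ for every $x \in M$. -/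

import Mathlib

open scoped Manifold ContDiff

noncomputable section

namespace ContactTorus

/-! ### Wedge products of alternating forms on a real vector space -/

section Wedge

variable {V : Type*} [AddCommGroup V] [Module ℝ V]

/-- The wedge product of two real-valued alternating forms (shuffle normalization). -/
def wedge {p q : ℕ} (a : V [⋀^Fin p]→ₗ[ℝ] ℝ) (b : V [⋀^Fin q]→ₗ[ℝ] ℝ) :
    V [⋀^Fin (p + q)]→ₗ[ℝ] ℝ :=
  ((LinearMap.mul' ℝ ℝ).compAlternatingMap (a.domCoprod b)).domDomCongr finSumFinEquiv

/-- The `n`-fold wedge power of a `2`-form. -/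
def wedgePow (b : V [⋀^Fin 2]→ₗ[ℝ] ℝ) : (n : ℕ) → V [⋀^Fin (2 * n)]→ₗ[ℝ] ℝ
  | 0 => (AlternatingMap.constOfIsEmpty ℝ V (Fin 0) (1 : ℝ) : V [⋀^Fin 0]→ₗ[ℝ] ℝ)
  | n + 1 => wedge (wedgePow b n) b

end Wedge

/-! ### Differential `1`-forms and contact forms on a manifold without boundary -/

section Forms

variable {E : Type*} [NormedAddCommGroup E] [NormedSpace ℝ E]
  {H : Type*} [TopologicalSpace H] (J : ModelWithCorners ℝ E H)
  {M : Type*} [TopologicalSpace M] [ChartedSpace H M]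

/-- Smoothness of a `1`-form, as a section of the cotangent bundle. -/
def IsSmoothOneForm [IsManifold J ∞ M] (α : ∀ x : M, TangentSpace J x →L[ℝ] ℝ) : Prop :=
  ContMDiff J (J.prod 𝓘(ℝ, E →L[ℝ] ℝ)) ∞
    (fun x : M ↦ Bundle.TotalSpace.mk' (E →L[ℝ] ℝ)
      (E := fun x : M ↦ TangentSpace J x →L[ℝ] ℝ) x (α x))

/-- The `1`-form `α` read in the preferred chart `φ` at `x₀`, that is `(φ⁻¹)^* α`. -/
def oneFormInChart (α : ∀ x : M, TangentSpace J x →L[ℝ] ℝ) (x₀ : M) (y : E) : E →L[ℝ] ℝ :=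
  (α ((extChartAt J x₀).symm y)).comp (mfderiv 𝓘(ℝ, E) J (extChartAt J x₀).symm y)

/-- The exterior derivative of a `1`-form at `x`: the pull-back, by the preferred chart `φ` at
`x`, of the exterior derivative of `(φ⁻¹)^* α` on the model vector space. -/
def dOneForm (α : ∀ x : M, TangentSpace J x →L[ℝ] ℝ) (x : M) :
    TangentSpace J x [⋀^Fin 2]→L[ℝ] ℝ :=
  (extDeriv
    (fun y : E ↦ ContinuousAlternatingMap.ofSubsingleton ℝ E ℝ (0 : Fin 1)
      (oneFormInChart J α x y))
    (extChartAt J x x)).compContinuousLinearMap (mfderiv J 𝓘(ℝ, E) (extChartAt J x) x)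

/-- `α` is a contact form: `M` has dimension `2n+1` for some `n`, `α` is a smooth `1`-form, and
`α ∧ (dα)^n` vanishes at no point. -/
def IsContactForm [IsManifold J ∞ M] (α : ∀ x : M, TangentSpace J x →L[ℝ] ℝ) : Prop :=
  IsSmoothOneForm J α ∧
    ∃ n : ℕ, Module.finrank ℝ E = 2 * n + 1 ∧
      ∀ x : M, wedge (AlternatingMap.ofSubsingleton ℝ (TangentSpace J x) ℝ (0 : Fin 1)
        (α x).toLinearMap) (wedgePow (dOneForm J α x).toAlternatingMap n) ≠ 0

end Forms

/-! ### Group actions, moment maps, tori -/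

section Actions

variable {F : Type*} [NormedAddCommGroup F] [NormedSpace ℝ F]
  {K : Type*} [TopologicalSpace K] (I : ModelWithCorners ℝ F K)
  {E : Type*} [NormedAddCommGroup E] [NormedSpace ℝ E]
  {H : Type*} [TopologicalSpace H] (J : ModelWithCorners ℝ E H)
  (G : Type*) [TopologicalSpace G] [ChartedSpace K G] [Group G]
  {M : Type*} [TopologicalSpace M] [ChartedSpace H M] [MulAction G M]

/-- A torus: a Lie group isomorphic, as a Lie group, to a finite power of the circle group. -/
def IsTorus : Prop :=
  ∃ (k : ℕ) (e : G ≃* (Fin k → Circle)),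
    ContMDiff I (ModelWithCorners.pi fun _ : Fin k ↦ 𝓡 1) ∞ e ∧
    ContMDiff (ModelWithCorners.pi fun _ : Fin k ↦ 𝓡 1) I ∞ e.symm

/-- The action of `G` preserves the `1`-form `α`: `g^* α = α` for every `g`. -/
def IsInvariantOneForm (α : ∀ x : M, TangentSpace J x →L[ℝ] ℝ) : Prop :=
  ∀ (g : G) (x : M) (v : TangentSpace J x),
    α (g • x) (mfderiv J J (fun y : M ↦ g • y) x v) = α x v

/-- The linear map `A ↦ A_M(x)` from the Lie algebra of `G` to `T_x M`, where `A_M` is the vector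
field induced by `A`: the derivative at `1` of the orbit map `g ↦ g • x`. (Here `1 • x = x`, and
the tangent spaces at these two equal points are identified.) -/
def inducedVector (x : M) : GroupLieAlgebra I G →L[ℝ] TangentSpace J x :=
  (mfderiv I J (fun g : G ↦ g • x) (1 : G) : F →L[ℝ] E)

/-- The moment map `Φ` of the lifted action on the cotangent bundle:
`⟨Φ(q, p), A⟩ = ⟨p, A_M(q)⟩`. -/
def cotangentMomentMap (q : M) (p : TangentSpace J q →L[ℝ] ℝ) :
    Module.Dual ℝ (GroupLieAlgebra I G) :=
  (p.comp (inducedVector I J G q)).toLinearMap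

/-- The moment map `Ψ_α : M → 𝔤^*` defined by an invariant contact form `α`:
`⟨Ψ_α(x), A⟩ = α_x(A_M(x))`. -/
def momentMap (α : ∀ x : M, TangentSpace J x →L[ℝ] ℝ) (x : M) :
    Module.Dual ℝ (GroupLieAlgebra I G) :=
  cotangentMomentMap I J G x (α x)

end Actions

end ContactTorus

end

/-! Suppose `Ψ_α(x) = 0`, so that the orbit through `x` is tangent to `ξ`. Let the universal cover
`T = ℝᵏ` of the torus act through `exp`, with infinitesimal action `D : T → T_xM`. The pullback of
`α` to `T` along the orbit map is translation invariant and zero at the origin, hence zero;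
therefore `dα` vanishes on `range D`.

The stabilizer algebra `ker D` acts on `T_xM` by commuting operators `X A`, the generators of the
isotropy representation. They take values in `ker α`, are skew for `dα`, kill `range D`, and satisfy
`ker (X A)² = ker (X A)` because the representation is bounded. They are also faithful: a
one-parameter subgroup fixing `x` with trivial derivative there acts trivially on connected `M`
(`fixed_of_linAct_eq_id`).

Hence some `v` makes `A ↦ X A v` injective (`exists_injective_apply`), and `range D ⊕ {X A v}` is a
`dα`-isotropic subspace of `ker α` of dimension `rank D + dim ker D = k`. The contact condition
bounds such subspaces by `n` (`finrank_isotropic_le`), whereas `dim M + 1 = 2 dim G` forces `k ≥ n +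
1`. -/

noncomputable section

namespace ContactTorus

/-! ### Linear algebra: isotropic subspaces and commuting skew operators -/

section LinearAlgebra

variable {V : Type*} [AddCommGroup V] [Module ℝ V]

/-- An alternating form vanishes as soon as more than `j` of its arguments lie in `L`. -/
def VanishesAbove {p : ℕ} (a : V [⋀^Fin p]→ₗ[ℝ] ℝ) (L : Submodule ℝ V) (j : ℕ) : Prop :=
  ∀ v : Fin p → V, j < Nat.card {i // v i ∈ L} → a v = 0

/-- Pigeonhole in each shuffle term: if more than `i + j` arguments lie in `L`, then either `a`
receives more than `i` of them or `b` more than `j`. -/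
theorem VanishesAbove.wedge {p q : ℕ} {a : V [⋀^Fin p]→ₗ[ℝ] ℝ} {b : V [⋀^Fin q]→ₗ[ℝ] ℝ}
    {L : Submodule ℝ V} {i j : ℕ} (ha : VanishesAbove a L i) (hb : VanishesAbove b L j) :
    VanishesAbove (wedge a b) L (i + j) := by
  intro v hv
  simp only [ContactTorus.wedge, AlternatingMap.domDomCongr_apply,
    LinearMap.compAlternatingMap_apply, AlternatingMap.domCoprod_apply, _root_.sum_apply,
    map_sum]
  refine Finset.sum_eq_zero fun σ _ ↦ ?_
  induction σ using Quotient.inductionOn' with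
  | h σ =>
  rw [AlternatingMap.domCoprod.summand_mk'']
  simp only [_root_.smul_apply, MultilinearMap.domDomCongr_apply,
    MultilinearMap.domCoprod_apply, map_zsmul_unit, LinearMap.mul'_apply]
  set w : Fin p ⊕ Fin q → V := fun s ↦ v (finSumFinEquiv (σ s))
  have key : Nat.card {t // v t ∈ L} =
      Nat.card {s // w (Sum.inl s) ∈ L} + Nat.card {s // w (Sum.inr s) ∈ L} := by
    rw [← Nat.card_sum]
    refine Nat.card_congr (Equiv.trans (Equiv.symm ?_) (Equiv.subtypeSum (p := fun s ↦ w s ∈ L)))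
    exact (σ.trans finSumFinEquiv).subtypeEquiv fun s ↦ Iff.rfl
  have h0 : a (fun s ↦ w (Sum.inl s)) * b (fun s ↦ w (Sum.inr s)) = 0 := by
    rcases lt_or_ge i (Nat.card {s // w (Sum.inl s) ∈ L}) with h | h
    · rw [ha _ h, zero_mul]
    · rw [hb _ (by omega), mul_zero]
  rw [smul_eq_zero_iff_eq]
  exact h0

theorem VanishesAbove.wedgePow {b : V [⋀^Fin 2]→ₗ[ℝ] ℝ} {L : Submodule ℝ V}
    (hb : VanishesAbove b L 1) : ∀ n : ℕ, VanishesAbove (wedgePow b n) L n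
  | 0 => fun v hv ↦ by
      have : Nat.card {i // v i ∈ L} ≤ Nat.card (Fin (2 * 0)) :=
        Nat.card_le_card_of_injective _ Subtype.val_injective
      simp at this hv
  | n + 1 => (VanishesAbove.wedgePow hb n).wedge hb

theorem vanishesAbove_two {b : V [⋀^Fin 2]→ₗ[ℝ] ℝ} {L : Submodule ℝ V}
    (h : ∀ v ∈ L, ∀ w ∈ L, b ![v, w] = 0) : VanishesAbove b L 1 := by
  intro v hv
  have h2 : ∀ i, v i ∈ L := by
    by_contra! hne
    obtain ⟨i, hi⟩ := hne
    have : Nat.card {i // v i ∈ L} ≤ Nat.card {j // j ≠ i} :=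
      Nat.card_le_card_of_injective
        (fun s ↦ ⟨s.1, fun hs ↦ hi (hs ▸ s.2)⟩) fun s t hst ↦ by
          simpa [Subtype.ext_iff] using hst
    simp [Nat.card_eq_fintype_card, Fintype.card_subtype_compl] at this
    omega
  have hv' : v = ![v 0, v 1] := by ext i; fin_cases i <;> rfl
  rw [hv']
  exact h _ (h2 0) _ (h2 1)

/-- If `a ∧ bⁿ ≠ 0` in dimension `2n+1`, then a subspace of `ker a` that is isotropic for `b` has
dimension at most `n`. -/
theorem finrank_isotropic_le [FiniteDimensional ℝ V] {n : ℕ} (hn : Module.finrank ℝ V = 2 * n + 1)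
    (a : V →ₗ[ℝ] ℝ) (b : V [⋀^Fin 2]→ₗ[ℝ] ℝ)
    (hab : wedge (AlternatingMap.ofSubsingleton ℝ V ℝ (0 : Fin 1) a) (wedgePow b n) ≠ 0)
    (L : Submodule ℝ V) (ha : ∀ v ∈ L, a v = 0) (hb : ∀ v ∈ L, ∀ w ∈ L, b ![v, w] = 0) :
    Module.finrank ℝ L ≤ n := by
  by_contra! hlt
  apply hab
  have ha' : VanishesAbove (AlternatingMap.ofSubsingleton ℝ V ℝ (0 : Fin 1) a) L 0 := by
    intro v hv
    obtain ⟨⟨i, hi⟩⟩ := (Nat.card_pos_iff.1 hv).1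
    obtain rfl : i = 0 := Subsingleton.elim _ _
    simpa using ha _ hi
  have hw := ha'.wedge ((vanishesAbove_two hb).wedgePow n)
  -- It suffices to evaluate on a basis adapted to `L ⊕ L'`. Distinct basis vectors filling all `2n
  -- + 1` slots use the whole basis, so more than `n = 0 + n` of them lie in `L`.
  obtain ⟨L', hL'⟩ := L.exists_isCompl
  let e := ((Module.finBasis ℝ L).prod (Module.finBasis ℝ L')).map
    (Submodule.prodEquivOfIsCompl L L' hL')
  refine e.ext_alternating fun v hv ↦ ?_
  have hcard : Nat.card (Fin (1 + 2 * n)) =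
      Nat.card (Fin (Module.finrank ℝ L) ⊕ Fin (Module.finrank ℝ L')) := by
    have := Submodule.finrank_add_eq_of_isCompl hL'
    simp
    omega
  have hbij : Function.Bijective v :=
    (Nat.bijective_iff_injective_and_card v).2 ⟨hv, hcard⟩
  refine (hw _ ?_).trans (AlternatingMap.zero_apply _).symm
  have : Nat.card (Fin (Module.finrank ℝ L)) ≤ Nat.card {i // e (v i) ∈ L} := by
    refine Nat.card_le_card_of_injective
      (fun s ↦ ⟨(Equiv.ofBijective v hbij).symm (Sum.inl s), ?_⟩) fun s t hst ↦ ?_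
    · have := (Equiv.ofBijective v hbij).apply_symm_apply (Sum.inl s)
      rw [Equiv.ofBijective_apply] at this
      rw [this]
      simp [e]
    · simpa using hst
  rw [Nat.card_fin] at this
  omega

/-- A vector at which evaluation is injective on a space of commuting operators `X A` with
`ker (X A) ∩ range (X A) = 0`. -/
theorem exists_injective_apply {𝔨 : Type*} [AddCommGroup 𝔨] [Module ℝ 𝔨] [FiniteDimensional ℝ 𝔨]
    (X : 𝔨 →ₗ[ℝ] V →ₗ[ℝ] V) (hcomm : ∀ A B v, X A (X B v) = X B (X A v))
    (hss : ∀ A v, X A (X A v) = 0 → X A v = 0) (hinj : ∀ A, X A = 0 → A = 0) :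
    ∃ v, ∀ A, X A v = 0 → A = 0 := by
  let N : V → Submodule ℝ 𝔨 := fun v ↦ LinearMap.ker (X.flip v)
  obtain ⟨v, hv⟩ : ∃ v, ∀ u, Module.finrank ℝ (N v) ≤ Module.finrank ℝ (N u) := by
    exact ⟨Function.argmin fun v ↦ Module.finrank ℝ (N v), fun u ↦
      Function.argmin_le (fun v ↦ Module.finrank ℝ (N v)) u⟩
  refine ⟨v, fun A hA ↦ hinj A ?_⟩
  by_contra hne
  obtain ⟨w, hw⟩ : ∃ w, X A w ≠ 0 := by
    by_contra! h
    exact hne (LinearMap.ext h)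
  -- Here `v` minimizes the dimension of its annihilator. If `A` killed `v` but not `w`, then `v + X
  -- A w` would do better: `v ∈ ker (X A)` and `X A w ∈ range (X A)` lie in independent subspaces
  -- preserved by every `X B`, so `B` kills the sum only if it kills both terms, and `A` does not.
  have hlt : N (v + X A w) < N v := by
    have hle : ∀ B, X B (v + X A w) = 0 → X B v = 0 ∧ X B (X A w) = 0 := by
      intro B hB
      rw [map_add] at hB
      have h1 : X A (X B (X A w)) = 0 := by
        have := congrArg (X A) hB
        rwa [map_add, hcomm A B v, hA, map_zero, map_zero, zero_add] at this
      have h2 : X B (X A w) = 0 := by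
        rw [hcomm B A] at h1 ⊢
        exact hss _ _ h1
      exact ⟨by simpa [h2] using hB, h2⟩
    refine lt_of_le_of_ne (fun B hB ↦ ?_) fun heq ↦ ?_
    · exact (hle B (by simpa [N] using hB)).1
    · have : A ∈ N (v + X A w) := heq ▸ (by simpa [N] using hA)
      exact hw (hss _ _ (hle A (by simpa [N] using this)).2)
  exact absurd (Submodule.finrank_lt_finrank_of_lt hlt) (not_lt.2 (hv _))

/-- The linear algebra behind the main theorem: `D` is the infinitesimal action at a point whose
orbit is tangent to `ker a`, and `X` is the linear isotropy representation of `ker D`. -/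
theorem finrank_le_of_isotropy [FiniteDimensional ℝ V] {n : ℕ}
    (hn : Module.finrank ℝ V = 2 * n + 1) (a : V →ₗ[ℝ] ℝ) (b : V [⋀^Fin 2]→ₗ[ℝ] ℝ)
    (hab : wedge (AlternatingMap.ofSubsingleton ℝ V ℝ (0 : Fin 1) a) (wedgePow b n) ≠ 0)
    {T : Type*} [AddCommGroup T] [Module ℝ T] [FiniteDimensional ℝ T] (D : T →ₗ[ℝ] V)
    (haD : ∀ v, a (D v) = 0) (hbD : ∀ v w, b ![D v, D w] = 0)
    (X : LinearMap.ker D →ₗ[ℝ] V →ₗ[ℝ] V) (hcomm : ∀ A B v, X A (X B v) = X B (X A v))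
    (hss : ∀ A v, X A (X A v) = 0 → X A v = 0) (hinj : ∀ A, X A = 0 → A = 0)
    (haX : ∀ A v, a (X A v) = 0) (hbX : ∀ A v w, b ![X A v, w] + b ![v, X A w] = 0)
    (hXD : ∀ A v, X A (D v) = 0) : Module.finrank ℝ T ≤ n := by
  obtain ⟨v, hv⟩ := exists_injective_apply X hcomm hss hinj
  have hswap : ∀ x y, b ![x, y] = -b ![y, x] := by
    intro x y
    have := b.map_swap ![y, x] (i := 0) (j := 1) (by decide)
    rw [← this]
    congr 1
    ext i
    fin_cases i <;> rfl
  -- Skewness gives `b (X A v, X B v) = -b (v, X A (X B v))`, which is symmetric in `A`, `B` by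
  -- commutativity, yet `b` is alternating.
  have hXX : ∀ A B, b ![X A v, X B v] = 0 := by
    intro A B
    have h1 := hbX A v (X B v)
    have h2 := hbX B v (X A v)
    rw [hcomm A B] at h1
    rw [hswap (X B v)] at h2
    linarith
  have hXDz : ∀ A w, b ![X A v, D w] = 0 := by
    intro A w
    have h1 := hbX A v (D w)
    have h0 : b ![v, 0] = 0 := b.map_coord_zero (i := 1) rfl
    rw [hXD, h0] at h1
    linarith
  let L := LinearMap.range D ⊔ LinearMap.range (X.flip v)
  have hL : ∀ y ∈ L, ∃ w A, y = D w + X A v := by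
    intro y hy
    obtain ⟨_, ⟨w, rfl⟩, _, ⟨A, rfl⟩, rfl⟩ := Submodule.mem_sup.1 hy
    exact ⟨w, A, rfl⟩
  have hadd : ∀ x y z w, b ![x + y, z + w] =
      b ![x, z] + b ![x, w] + (b ![y, z] + b ![y, w]) := by
    have e2 : ∀ x y z, b ![x, y + z] = b ![x, y] + b ![x, z] := by
      intro x y z
      have hu : ∀ y, Function.update ![x, 0] 1 y = ![x, y] := by
        intro y
        ext i
        fin_cases i <;> rfl
      have := b.map_update_add ![x, 0] 1 y z
      rwa [hu, hu, hu] at this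
    have e1 : ∀ x y z, b ![x + y, z] = b ![x, z] + b ![y, z] := by
      intro x y z
      rw [hswap, e2, hswap z, hswap z]
      ring
    intro x y z w
    rw [e1, e2, e2]
  have hle := finrank_isotropic_le hn a b hab L
    (fun y hy ↦ by
      obtain ⟨w, A, rfl⟩ := hL y hy
      simp [haD, haX])
    (fun y hy z hz ↦ by
      obtain ⟨w, A, rfl⟩ := hL y hy
      obtain ⟨w', A', rfl⟩ := hL z hz
      rw [hadd, hbD, hXX, hXDz, hswap, hXDz]
      simp)
  -- If `X A v = D w`, then `X A (X A v) = X A (D w) = 0`, so `X A v = 0`.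
  have hdisj : LinearMap.range D ⊓ LinearMap.range (X.flip v) = ⊥ := by
    rw [eq_bot_iff]
    rintro _ ⟨⟨w, rfl⟩, A, hA⟩
    change X A v = D w at hA
    have h0 := hss A v (by rw [hA, hXD])
    simp [← hA, h0]
  have h1 := Submodule.finrank_sup_add_finrank_inf_eq (LinearMap.range D)
    (LinearMap.range (X.flip v))
  have h2 := LinearMap.finrank_range_add_finrank_ker D
  have h3 : Module.finrank ℝ (LinearMap.range (X.flip v)) = Module.finrank ℝ (LinearMap.ker D) := by
    refine LinearMap.finrank_range_of_inj ?_
    rw [← LinearMap.ker_eq_bot, LinearMap.ker_eq_bot']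
    exact hv
  rw [hdisj, finrank_bot] at h1
  change Module.finrank ℝ L + 0 = _ at h1
  omega

end LinearAlgebra

/-! ### One-parameter groups of operators -/

section OneParameterGroups

variable {E : Type*} [NormedAddCommGroup E] [NormedSpace ℝ E]

theorem hasDerivAt_of_map_add {ρ : ℝ → E →L[ℝ] E} {X : E →L[ℝ] E}
    (hadd : ∀ s t, ρ (s + t) = ρ s ∘L ρ t) (hX : HasDerivAt ρ X 0) (t : ℝ) :
    HasDerivAt ρ (ρ t ∘L X) t := by
  have h1 : HasDerivAt (fun s ↦ ρ t ∘L ρ s) (ρ t ∘L X) 0 :=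
    ((ContinuousLinearMap.compL ℝ E E E (ρ t)).hasFDerivAt.comp_hasDerivAt _ hX)
  have h2 : HasDerivAt (fun s ↦ ρ t ∘L ρ s) (ρ t ∘L X) (t - t) := by rwa [sub_self]
  have h3 := h2.comp_sub_const t t
  refine h3.congr_of_eventuallyEq (Filter.Eventually.of_forall fun s ↦ ?_)
  change ρ s = ρ t ∘L ρ (s - t)
  rw [← hadd, add_sub_cancel]

theorem eq_id_of_hasDerivAt_zero {ρ : ℝ → E →L[ℝ] E}
    (hadd : ∀ s t, ρ (s + t) = ρ s ∘L ρ t) (h0 : ρ 0 = ContinuousLinearMap.id ℝ E)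
    (hX : HasDerivAt ρ 0 0) (t : ℝ) : ρ t = ContinuousLinearMap.id ℝ E := by
  have h := hasDerivAt_of_map_add hadd hX
  simp only [ContinuousLinearMap.comp_zero] at h
  rw [← h0]
  exact is_const_of_deriv_eq_zero (fun s ↦ (h s).differentiableAt) (fun s ↦ (h s).deriv) t 0

/-- The generator of a bounded one-parameter group satisfies `ker X² = ker X`. -/
theorem generator_apply_eq_zero_of_bounded {ρ : ℝ → E →L[ℝ] E} {X : E →L[ℝ] E}
    (hadd : ∀ s t, ρ (s + t) = ρ s ∘L ρ t) (h0 : ρ 0 = ContinuousLinearMap.id ℝ E)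
    (hX : HasDerivAt ρ X 0) {C : ℝ} (hC : ∀ t, ‖ρ t‖ ≤ C) {v : E} (hv : X (X v) = 0) :
    X v = 0 := by
  have hd : ∀ (w : E) (t : ℝ), HasDerivAt (fun t ↦ ρ t w) (ρ t (X w)) t := by
    intro w t
    have := (hasDerivAt_of_map_add hadd hX t).clm_apply (hasDerivAt_const t w)
    simpa using this
  have hXv : ∀ t, ρ t (X v) = X v := by
    intro t
    have h := hd (X v)
    simp only [hv, map_zero] at h
    have := is_const_of_deriv_eq_zero (fun s ↦ (h s).differentiableAt) (fun s ↦ (h s).deriv) t 0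
    simpa [h0] using this
  have hlin : ∀ t : ℝ, ρ t v = v + t • X v := by
    intro t
    have h : ∀ s, HasDerivAt (fun s : ℝ ↦ ρ s v - s • X v) 0 s := by
      intro s
      have := (hd v s).sub ((hasDerivAt_id s).smul_const (X v))
      rw [hXv, one_smul, sub_self] at this
      exact this
    have := is_const_of_deriv_eq_zero (fun s ↦ (h s).differentiableAt) (fun s ↦ (h s).deriv) t 0
    simp only [h0, ContinuousLinearMap.id_apply, zero_smul, sub_zero] at this
    exact sub_eq_iff_eq_add.1 this
  have hb : ∀ t : ℝ, 0 < t → t * ‖X v‖ ≤ C * ‖v‖ + ‖v‖ := by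
    intro t ht
    have h1 : t • X v = ρ t v - v := by rw [hlin]; abel
    calc t * ‖X v‖ = ‖t • X v‖ := by rw [norm_smul, Real.norm_of_nonneg ht.le]
      _ ≤ ‖ρ t v‖ + ‖v‖ := by rw [h1]; exact norm_sub_le _ _
      _ ≤ C * ‖v‖ + ‖v‖ := by
        gcongr
        exact (ρ t).le_of_opNorm_le (hC t) v
  by_contra hne
  have hpos : 0 < ‖X v‖ := norm_pos_iff.2 hne
  obtain ⟨m, hm⟩ := exists_nat_gt ((C * ‖v‖ + ‖v‖) / ‖X v‖)
  have := hb (m + 1) (by positivity)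
  rw [div_lt_iff₀ hpos] at hm
  nlinarith

end OneParameterGroups

/-! ### Actions read in a chart -/

section ChartAct

open Topology

variable {T : Type*} {E : Type*} [NormedAddCommGroup E] [NormedSpace ℝ E]
  {H : Type*} [TopologicalSpace H] {J : ModelWithCorners ℝ E H}
  {M : Type*} [TopologicalSpace M] [ChartedSpace H M]

/-- An action read in the preferred chart at `x`. -/
def chartAct (J : ModelWithCorners ℝ E H) (act : T → M → M) (x : M) (v : T) (z : E) : E :=
  extChartAt J x (act v ((extChartAt J x).symm z))

/-- The pairs `(v, z)` where the action read in the chart at `x` is meaningful. -/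
def chartActDomain (J : ModelWithCorners ℝ E H) (act : T → M → M) (x : M) : Set (T × E) :=
  {p | p.2 ∈ (extChartAt J x).target ∧
    act p.1 ((extChartAt J x).symm p.2) ∈ (extChartAt J x).source}

theorem chartAct_congr {act : T → M → M} {v w : T} (h : act v = act w) (x : M) :
    chartAct J act x v = chartAct J act x w := by
  ext z
  simp [chartAct, h]

theorem mem_chartActDomain_of_fixed {act : T → M → M} {x : M} {v : T} (h : act v x = x) :
    (v, extChartAt J x x) ∈ chartActDomain J act x := by
  simp [chartActDomain, h]

theorem chartAct_of_fixed {act : T → M → M} {x : M} {v : T} (h : act v x = x) :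
    chartAct J act x v (extChartAt J x x) = extChartAt J x x := by
  simp [chartAct, h]

theorem symm_chartAct {act : T → M → M} {x : M} {v : T} {z : E}
    (h : (v, z) ∈ chartActDomain J act x) :
    (extChartAt J x).symm (chartAct J act x v z) = act v ((extChartAt J x).symm z) :=
  (extChartAt J x).left_inv h.2

theorem chartAct_mem_target {act : T → M → M} {x : M} {v : T} {z : E}
    (h : (v, z) ∈ chartActDomain J act x) :
    chartAct J act x v z ∈ (extChartAt J x).target :=
  (extChartAt J x).map_source h.2

/-- The derivative at `x` of the diffeomorphism `act v`, read in the chart at `x`. -/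
def linAct (J : ModelWithCorners ℝ E H) (act : T → M → M) (x : M) (v : T) : E →L[ℝ] E :=
  fderiv ℝ (chartAct J act x v) (extChartAt J x x)

theorem linAct_eq_id_of_eventually_fixed [J.Boundaryless] {act : T → M → M}
    {x : M} {v : T} (h : ∀ᶠ p in 𝓝 x, act v p = p) :
    linAct J act x v = ContinuousLinearMap.id ℝ E := by
  have hev : chartAct J act x v =ᶠ[𝓝 (extChartAt J x x)] id := by
    have h1 : ∀ᶠ z in 𝓝 (extChartAt J x x),
        act v ((extChartAt J x).symm z) = (extChartAt J x).symm z := by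
      refine (continuousAt_extChartAt_symm (I := J) x).eventually
        (p := fun p ↦ act v p = p) ?_
      rwa [extChartAt_to_inv]
    filter_upwards [h1, extChartAt_target_mem_nhds x] with z hz hzt
    rw [chartAct, hz, (extChartAt J x).right_inv hzt, id]
  rw [linAct, hev.fderiv_eq, fderiv_id]

end ChartAct

/-! ### Toral actions and their smoothness in charts -/

section ToralActions

open Filter Topology

variable {T : Type*} [NormedAddCommGroup T] [NormedSpace ℝ T]
  {E : Type*} [NormedAddCommGroup E] [NormedSpace ℝ E]
  {H : Type*} [TopologicalSpace H] {J : ModelWithCorners ℝ E H}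
  {M : Type*} [TopologicalSpace M] [ChartedSpace H M]

/-- A smooth action of the additive group of `T` that factors through a compact quotient. -/
structure IsToralAction (J : ModelWithCorners ℝ E H) (act : T → M → M) : Prop where
  smooth : ContMDiff (𝓘(ℝ, T).prod J) J ∞ fun p : T × M ↦ act p.1 p.2
  zero : ∀ p, act 0 p = p
  add : ∀ v w p, act (v + w) p = act v (act w p)
  compact : ∃ Q : Set T, IsCompact Q ∧ ∀ v, ∃ q ∈ Q, act q = act v

namespace IsToralAction

variable {act : T → M → M} (ha : IsToralAction J act)
include ha

theorem chartAct_add {x : M} {v w : T} {z : E} (h : (v, z) ∈ chartActDomain J act x) :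
    chartAct J act x (w + v) z = chartAct J act x w (chartAct J act x v z) := by
  rw [chartAct, chartAct, symm_chartAct h, ha.add]

theorem chartAct_zero {x : M} {z : E} (h : z ∈ (extChartAt J x).target) :
    chartAct J act x 0 z = z := by
  rw [chartAct, ha.zero, (extChartAt J x).right_inv h]

theorem continuous_act : Continuous fun p : T × M ↦ act p.1 p.2 := ha.smooth.continuous

theorem smooth_act (v : T) : ContMDiff J J ∞ (act v) :=
  ha.smooth.comp (contMDiff_const.prodMk contMDiff_id)

theorem isClosed_fixed [T2Space M] (v : T) : IsClosed {p | act v p = p} :=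
  isClosed_eq (ha.smooth_act v).continuous continuous_id

theorem isClosed_stabilizer [T2Space M] (x : M) : IsClosed {v | act v x = x} :=
  isClosed_eq (ha.continuous_act.comp (Continuous.prodMk_left x)) continuous_const

theorem zero_mem_chartActDomain (x : M) : ((0 : T), extChartAt J x x) ∈ chartActDomain J act x :=
  mem_chartActDomain_of_fixed (ha.zero x)

theorem act_nsmul_of_fixed {x : M} {v : T} (hv : act v x = x) (n : ℕ) : act (n • v) x = x := by
  induction n with
  | zero => simpa using ha.zero x
  | succ n ih => rw [succ_nsmul, ha.add, hv, ih]

variable [J.Boundaryless]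

theorem isOpen_chartActDomain (x : M) : IsOpen (chartActDomain J act x) := by
  have hc : ContinuousOn (fun p : T × E ↦ act p.1 ((extChartAt J x).symm p.2))
      (Prod.snd ⁻¹' (extChartAt J x).target) :=
    ha.continuous_act.comp_continuousOn <| continuousOn_fst.prodMk <|
      (continuousOn_extChartAt_symm x).comp continuousOn_snd fun _ h ↦ h
  exact hc.isOpen_inter_preimage ((isOpen_extChartAt_target x).preimage continuous_snd)
    (isOpen_extChartAt_source x)

theorem linAct_zero (x : M) : linAct J act x 0 = ContinuousLinearMap.id ℝ E :=
  linAct_eq_id_of_eventually_fixed (Eventually.of_forall ha.zero)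

theorem eventually_mem_chartActDomain_left {x : M} {v : T} {z : E}
    (h : (v, z) ∈ chartActDomain J act x) :
    ∀ᶠ w in 𝓝 v, (w, z) ∈ chartActDomain J act x :=
  (Continuous.prodMk_left z).continuousAt.eventually
    ((ha.isOpen_chartActDomain x).eventually_mem h)

theorem eventually_mem_chartActDomain_right {x : M} {v : T} {z : E}
    (h : (v, z) ∈ chartActDomain J act x) :
    ∀ᶠ y in 𝓝 z, (v, y) ∈ chartActDomain J act x :=
  (Continuous.prodMk_right v).continuousAt.eventually
    ((ha.isOpen_chartActDomain x).eventually_mem h)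

variable [IsManifold J ∞ M]

theorem contDiffAt_chartAct {x : M} {p : T × E} (h : p ∈ chartActDomain J act x) :
    ContDiffAt ℝ ∞ (Function.uncurry (chartAct J act x)) p := by
  rw [← contMDiffAt_iff_contDiffAt]
  have h1 : ContMDiffAt 𝓘(ℝ, E) J ∞ (extChartAt J x).symm p.2 :=
    (contMDiffOn_extChartAt_symm x).contMDiffAt ((isOpen_extChartAt_target x).mem_nhds h.1)
  have h2 : ContMDiffAt J 𝓘(ℝ, E) ∞ (extChartAt J x) (act p.1 ((extChartAt J x).symm p.2)) :=
    contMDiffAt_extChartAt' (by simpa using h.2)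
  have h3 : ContMDiffAt 𝓘(ℝ, T × E) (𝓘(ℝ, T).prod J) ∞
      (fun p : T × E ↦ (p.1, (extChartAt J x).symm p.2)) p :=
    contDiff_fst.contMDiff.contMDiffAt.prodMk
      (ContMDiffAt.comp p h1 contDiff_snd.contMDiff.contMDiffAt)
  exact ContMDiffAt.comp p h2 (ContMDiffAt.comp p ha.smooth.contMDiffAt h3)

theorem contDiffAt_fderiv_chartAct {x : M} {p : T × E} (h : p ∈ chartActDomain J act x) :
    ContDiffAt ℝ ∞ (fun p : T × E ↦ fderiv ℝ (chartAct J act x p.1) p.2) p := by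
  refine ContDiffAt.fderiv (f := fun q : T × E ↦ chartAct J act x q.1) (n := ∞) ?_
    contDiffAt_snd (by simp)
  exact (ha.contDiffAt_chartAct h).comp (p, p.2)
    (f := fun q : (T × E) × E ↦ (q.1.1, q.2)) (by fun_prop)

theorem contDiffAt_chartAct_right {x : M} {v : T} {z : E} (h : (v, z) ∈ chartActDomain J act x) :
    ContDiffAt ℝ ∞ (chartAct J act x v) z :=
  (ha.contDiffAt_chartAct h).comp z (f := fun z ↦ (v, z)) (by fun_prop)

theorem contDiffAt_chartAct_left {x : M} {v : T} {z : E} (h : (v, z) ∈ chartActDomain J act x) :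
    ContDiffAt ℝ ∞ (fun v ↦ chartAct J act x v z) v :=
  (ha.contDiffAt_chartAct h).comp v (f := fun v ↦ (v, z)) (by fun_prop)

theorem differentiableAt_chartAct_right {x : M} {v : T} {z : E}
    (h : (v, z) ∈ chartActDomain J act x) : DifferentiableAt ℝ (chartAct J act x v) z :=
  (ha.contDiffAt_chartAct_right h).differentiableAt (by simp)

end IsToralAction

end ToralActions

/-! ### Isotropy representation: boundedness and rigidity -/

section Linearization

open Filter Topology

variable {T : Type*} [NormedAddCommGroup T] [NormedSpace ℝ T]
  {E : Type*} [NormedAddCommGroup E] [NormedSpace ℝ E]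
  {H : Type*} [TopologicalSpace H] {J : ModelWithCorners ℝ E H}
  {M : Type*} [TopologicalSpace M] [ChartedSpace H M]

namespace IsToralAction

variable {act : T → M → M} (ha : IsToralAction J act) [J.Boundaryless] [IsManifold J ∞ M]
include ha

/-- Smoothness holds in all directions of `T`, not only along the stabilizer: `linAct` at nearby `w`
is still the derivative of the chart map at the same base point, even if `w` moves `x`. -/
theorem contDiffAt_linAct {x : M} {v : T} (h : act v x = x) :
    ContDiffAt ℝ ∞ (linAct J act x) v :=
  (ha.contDiffAt_fderiv_chartAct (mem_chartActDomain_of_fixed h)).comp v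
    (f := fun v ↦ (v, extChartAt J x x)) (by fun_prop)

theorem linAct_add {x : M} {v w : T} (hv : act v x = x) (hw : act w x = x) :
    linAct J act x (v + w) = linAct J act x v ∘L linAct J act x w := by
  have hw' := mem_chartActDomain_of_fixed (J := J) hw
  have hev : chartAct J act x (v + w) =ᶠ[𝓝 (extChartAt J x x)]
      chartAct J act x v ∘ chartAct J act x w := by
    have : ∀ᶠ z in 𝓝 (extChartAt J x x), (w, z) ∈ chartActDomain J act x :=
      (Continuous.prodMk_right w).continuousAt.eventually
        ((ha.isOpen_chartActDomain x).mem_nhds hw')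
    filter_upwards [this] with z hz using ha.chartAct_add hz
  rw [linAct, hev.fderiv_eq, fderiv_comp, chartAct_of_fixed hw, linAct, linAct]
  · rw [chartAct_of_fixed hw]
    exact ha.differentiableAt_chartAct_right (mem_chartActDomain_of_fixed hv)
  · exact ha.differentiableAt_chartAct_right hw'

theorem continuousOn_linAct (x : M) : ContinuousOn (linAct J act x) {v | act v x = x} :=
  fun _ hv ↦ (ha.contDiffAt_linAct hv).continuousAt.continuousWithinAt

/-- The isotropy representation of a toral action is bounded. -/
theorem exists_bound_linAct [T2Space M] (x : M) :
    ∃ C, ∀ v, act v x = x → ‖linAct J act x v‖ ≤ C := by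
  obtain ⟨Q, hQ, hcov⟩ := ha.compact
  obtain ⟨C, hC⟩ := (hQ.inter_right (ha.isClosed_stabilizer x)).exists_bound_of_continuousOn
    ((ha.continuousOn_linAct x).mono Set.inter_subset_right)
  refine ⟨C, fun v hv ↦ ?_⟩
  obtain ⟨q, hq, hqv⟩ := hcov v
  have := hC q ⟨hq, by simpa [hqv] using hv⟩
  rwa [linAct, chartAct_congr hqv] at this

/-- Elements that are closed under doubling, fix `x` and have trivial derivative at `x` act
trivially near `x`. -/
theorem eventually_fixed_of_linAct_eq_id [T2Space M] {x : M} {S : Set T}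
    (hS : ∀ v ∈ S, v + v ∈ S) (hfix : ∀ v ∈ S, act v x = x)
    (hlin : ∀ v ∈ S, linAct J act x v = ContinuousLinearMap.id ℝ E) :
    ∀ᶠ p in 𝓝 x, ∀ v ∈ S, act v p = p := by
  obtain ⟨Q, hQ, hcov⟩ := ha.compact
  set z₀ := extChartAt J x x with hz₀
  -- `S` may be unbounded, but each of its elements acts like one of the compact set `K`; this makes
  -- the estimates below uniform in `v ∈ S`.
  let K : Set T := Q ∩ ({v | act v x = x} ∩ linAct J act x ⁻¹' {ContinuousLinearMap.id ℝ E})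
  have hK : IsCompact K := hQ.inter_right <|
    (ha.continuousOn_linAct x).preimage_isClosed_of_isClosed (ha.isClosed_stabilizer x)
      isClosed_singleton
  have hSK : ∀ v ∈ S, ∃ q ∈ K, act q = act v := by
    intro v hv
    obtain ⟨q, hq, hqv⟩ := hcov v
    refine ⟨q, ⟨hq, by simpa [hqv] using hfix v hv, ?_⟩, hqv⟩
    have := hlin v hv
    rwa [linAct, ← chartAct_congr hqv] at this
  have hswap : ∀ q : T, Tendsto (fun p : E × T ↦ (p.2, p.1)) (𝓝 (z₀, q)) (𝓝 (q, z₀)) :=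
    fun q ↦ (continuous_swap.continuousAt (x := (z₀, q)))
  have h1 : ∀ᶠ z in 𝓝 z₀, ∀ q ∈ K, (q, z) ∈ chartActDomain J act x ∧
      ‖fderiv ℝ (chartAct J act x q) z - ContinuousLinearMap.id ℝ E‖ < 1 / 2 := by
    refine hK.eventually_forall_of_forall_eventually fun q hq ↦ (hswap q).eventually
      (p := fun p ↦ p ∈ chartActDomain J act x ∧
        ‖fderiv ℝ (chartAct J act x p.1) p.2 - ContinuousLinearMap.id ℝ E‖ < 1 / 2) ?_
    have hmem := mem_chartActDomain_of_fixed (J := J) hq.2.1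
    refine ((ha.isOpen_chartActDomain x).eventually_mem hmem).and ?_
    have hc := ((ha.contDiffAt_fderiv_chartAct hmem).continuousAt.sub
      (continuousAt_const (y := ContinuousLinearMap.id ℝ E))).norm
    refine hc.eventually (gt_mem_nhds ?_)
    have h0 : fderiv ℝ (chartAct J act x q) z₀ = ContinuousLinearMap.id ℝ E := hq.2.2
    change ‖fderiv ℝ (chartAct J act x q) z₀ - ContinuousLinearMap.id ℝ E‖ < 1 / 2
    rw [h0, sub_self, norm_zero]
    norm_num
  obtain ⟨r, hr, hball⟩ := Metric.eventually_nhds_iff_ball.1 h1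
  have h2 : ∀ᶠ z in 𝓝 z₀, ∀ q ∈ K, chartAct J act x q z ∈ Metric.ball z₀ r := by
    refine hK.eventually_forall_of_forall_eventually fun q hq ↦ (hswap q).eventually
      (p := fun p ↦ chartAct J act x p.1 p.2 ∈ Metric.ball z₀ r) ?_
    have hc := (ha.contDiffAt_chartAct
      (mem_chartActDomain_of_fixed (J := J) hq.2.1)).continuousAt
    refine hc.eventually (Metric.isOpen_ball.mem_nhds ?_)
    simp only [Function.uncurry]
    rw [chartAct_of_fixed hq.2.1]
    exact Metric.mem_ball_self hr
  have hdom : ∀ v ∈ S, ∀ z ∈ Metric.ball z₀ r, (v, z) ∈ chartActDomain J act x := by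
    intro v hv z hz
    obtain ⟨q, hq, hqv⟩ := hSK v hv
    have := (hball z hz q hq).1
    simpa [chartActDomain, hqv] using this
  have hgrow : ∀ z ∈ Metric.ball z₀ r, (∀ q ∈ K, chartAct J act x q z ∈ Metric.ball z₀ r) →
      ∀ v ∈ S, chartAct J act x v z = z := by
    intro z hz hzK v hv
    have hin : ∀ v ∈ S, chartAct J act x v z ∈ Metric.ball z₀ r := by
      intro v hv
      obtain ⟨q, hq, hqv⟩ := hSK v hv
      rw [← chartAct_congr hqv]
      exact hzK q hq
    -- Let `f` be the action of `v`, `δ = f z - z` and `ε = f (f z) - z`. Since `f - id` is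
    -- `1/2`-Lipschitz on the ball, `‖ε - 2δ‖ ≤ ‖δ‖ / 2`, so `‖δ‖ ≤ (2/3) ‖ε‖`. Doubling `v`
    -- repeatedly, with displacements never exceeding `2r`, forces `δ = 0`.
    have hdouble : ∀ v ∈ S, ‖chartAct J act x v z - z‖ ≤
        2 / 3 * ‖chartAct J act x (v + v) z - z‖ := by
      intro v hv
      obtain ⟨q, hq, hqv⟩ := hSK v hv
      have hmv := (convex_ball z₀ r).norm_image_sub_le_of_norm_fderiv_le (𝕜 := ℝ)
        (f := fun y ↦ chartAct J act x v y - y) (C := 1 / 2) (x := z)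
        (y := chartAct J act x v z)
        (fun y hy ↦ (ha.differentiableAt_chartAct_right (hdom v hv y hy)).sub
          differentiableAt_id) (fun y hy ↦ by
          rw [fderiv_fun_sub (ha.differentiableAt_chartAct_right (hdom v hv y hy))
            differentiableAt_fun_id, fderiv_fun_id, ← chartAct_congr hqv]
          exact (hball y hy q hq).2.le) hz (hin v hv)
      rw [← ha.chartAct_add (hdom v hv z hz)] at hmv
      set δ := chartAct J act x v z - z
      set ε := chartAct J act x (v + v) z - z
      have he : chartAct J act x (v + v) z - chartAct J act x v z - δ = ε - (2 : ℝ) • δ := by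
        simp only [δ, ε, two_smul]
        abel
      rw [he] at hmv
      have h3 : ‖(2 : ℝ) • δ‖ ≤ ‖ε‖ + ‖ε - (2 : ℝ) • δ‖ := by
        have := norm_sub_le ε (ε - (2 : ℝ) • δ)
        simpa using this
      rw [norm_smul, Real.norm_ofNat] at h3
      linarith
    have hpow : ∀ n : ℕ, ∀ v ∈ S, ‖chartAct J act x v z - z‖ ≤ (2 / 3) ^ n * (2 * r) := by
      intro n
      induction n with
      | zero =>
        intro v hv
        have h3 := Metric.mem_ball.1 (hin v hv)
        have h4 := Metric.mem_ball'.1 hz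
        rw [← dist_eq_norm]
        linarith [dist_triangle (chartAct J act x v z) z₀ z]
      | succ n ih =>
        intro v hv
        refine (hdouble v hv).trans ?_
        rw [pow_succ', mul_assoc]
        gcongr
        exact ih _ (hS v hv)
    have hlim : Tendsto (fun n : ℕ ↦ (2 / 3 : ℝ) ^ n * (2 * r)) atTop (𝓝 (0 * (2 * r))) :=
      (tendsto_pow_atTop_nhds_zero_of_lt_one (by norm_num) (by norm_num)).mul_const _
    rw [zero_mul] at hlim
    have := ge_of_tendsto' hlim fun n ↦ hpow n v hv
    exact sub_eq_zero.1 (norm_le_zero_iff.1 this)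
  have h3 : ∀ᶠ p in 𝓝 x, extChartAt J x p ∈ Metric.ball z₀ r ∧
      ∀ q ∈ K, chartAct J act x q (extChartAt J x p) ∈ Metric.ball z₀ r :=
    (continuousAt_extChartAt x).eventually
      ((Metric.isOpen_ball.eventually_mem (Metric.mem_ball_self hr)).and h2)
  filter_upwards [h3, extChartAt_source_mem_nhds (I := J) x] with p hp hps v hv
  have h4 := hgrow _ hp.1 hp.2 v hv
  have h5 := symm_chartAct (hdom v hv _ hp.1)
  rw [h4, (extChartAt J x).left_inv hps] at h5
  exact h5.symm

/-- A set of elements that is closed under doubling, fixes a point and has trivial derivative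
there acts trivially on a connected manifold. -/
theorem fixed_of_linAct_eq_id [T2Space M] [ConnectedSpace M] {x : M} {S : Set T}
    (hS : ∀ v ∈ S, v + v ∈ S) (hfix : ∀ v ∈ S, act v x = x)
    (hlin : ∀ v ∈ S, linAct J act x v = ContinuousLinearMap.id ℝ E) :
    ∀ v ∈ S, ∀ p, act v p = p := by
  let C : Set M := {y | ∀ᶠ p in 𝓝 y, ∀ v ∈ S, act v p = p}
  have hopen : IsOpen C := isOpen_setOfPred_eventually_nhds
  -- At a limit `y` of points of `C`, each `v ∈ S` fixes `y`, and its derivative in the one chart at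
  -- `y` is the identity at points of `C` near `y`, hence at `y` itself; the local result then
  -- applies at `y`.
  have hclosed : IsClosed C := by
    refine isClosed_of_closure_subset fun y hy ↦ ?_
    have hCfix : ∀ v ∈ S, C ⊆ {p | act v p = p} := fun v hv p hp ↦ hp.self_of_nhds v hv
    have hyfix : ∀ v ∈ S, act v y = y := fun v hv ↦
      closure_minimal (hCfix v hv) (ha.isClosed_fixed v) hy
    refine ha.eventually_fixed_of_linAct_eq_id hS hyfix fun v hv ↦ ?_
    set φ := extChartAt J y
    have hmem := mem_chartActDomain_of_fixed (J := J) (hyfix v hv)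
    have hc : ContinuousAt (fun p ↦ fderiv ℝ (chartAct J act y v) (φ p)) y := by
      have h1 : ContinuousAt (fun z ↦ fderiv ℝ (chartAct J act y v) z) (φ y) :=
        (ha.contDiffAt_fderiv_chartAct hmem).continuousAt.comp
          (f := fun z ↦ (v, z)) (Continuous.prodMk_right v).continuousAt
      exact h1.comp (continuousAt_extChartAt y)
    have hfreq : ∃ᶠ p in 𝓝 y, fderiv ℝ (chartAct J act y v) (φ p) =
        ContinuousLinearMap.id ℝ E := by
      refine ((mem_closure_iff_frequently.1 hy).and_eventually
        (extChartAt_source_mem_nhds (I := J) y)).mono ?_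
      rintro p ⟨hpC, hps⟩
      have hev : chartAct J act y v =ᶠ[𝓝 (φ p)] id := by
        have h1 : ∀ᶠ z in 𝓝 (φ p), act v (φ.symm z) = φ.symm z := by
          refine (continuousAt_extChartAt_symm' hps).eventually (p := fun q ↦ act v q = q) ?_
          rw [φ.left_inv hps]
          exact hpC.mono fun q hq ↦ hq v hv
        filter_upwards [h1, extChartAt_target_mem_nhds' (φ.map_source hps)] with z hz hzt
        rw [chartAct, hz, φ.right_inv hzt, id]
      rw [hev.fderiv_eq, fderiv_id]
    exact (isClosed_singleton (x := ContinuousLinearMap.id ℝ E)).mem_of_frequently_of_tendsto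
      hfreq hc
  have huniv : C = Set.univ :=
    IsClopen.eq_univ ⟨hclosed, hopen⟩ ⟨x, ha.eventually_fixed_of_linAct_eq_id hS hfix hlin⟩
  intro v hv p
  have hp : p ∈ C := huniv ▸ Set.mem_univ p
  exact hp.self_of_nhds v hv

end IsToralAction

end Linearization

/-! ### Invariant one-forms and orbit maps -/

section InvariantForms

open Filter Topology

variable {T : Type*} [NormedAddCommGroup T] [NormedSpace ℝ T]
  {E : Type*} [NormedAddCommGroup E] [NormedSpace ℝ E]
  {H : Type*} [TopologicalSpace H] {J : ModelWithCorners ℝ E H} [J.Boundaryless]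
  {M : Type*} [TopologicalSpace M] [ChartedSpace H M] [IsManifold J ∞ M]
  {α : ∀ x : M, TangentSpace J x →L[ℝ] ℝ}

theorem mfderiv_extChartAt_symm_self (x : M) :
    mfderiv 𝓘(ℝ, E) J (extChartAt J x).symm (extChartAt J x x) = ContinuousLinearMap.id ℝ E := by
  have : IsManifold J 1 M := .of_le (n := ∞) (by simp)
  rw [← mfderivWithin_univ, ← J.range_eq_univ]
  exact mfderivWithin_range_extChartAt_symm

theorem oneFormInChart_self (α : ∀ x : M, TangentSpace J x →L[ℝ] ℝ) (x : M) :
    oneFormInChart J α x (extChartAt J x x) = α x := by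
  have h : ∀ p : M, p = x → (α p : E →L[ℝ] ℝ) = α x := by rintro _ rfl; rfl
  rw [oneFormInChart, mfderiv_extChartAt_symm_self]
  exact h _ (extChartAt_to_inv x)

theorem differentiableAt_oneFormInChart (hα : IsSmoothOneForm J α) (x : M) :
    DifferentiableAt ℝ (oneFormInChart J α x) (extChartAt J x x) := by
  have : IsManifold J 1 M := .of_le (n := ∞) (by simp)
  have h1 := ((contMDiffAt_hom_bundle _).1 (hα x)).2
  have h2 : ContMDiffAt 𝓘(ℝ, E) J ∞ (extChartAt J x).symm (extChartAt J x x) :=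
    (contMDiffOn_extChartAt_symm x).contMDiffAt (extChartAt_target_mem_nhds x)
  have h3 := ContMDiffAt.comp_of_eq (x := extChartAt J x x) h1 h2 (extChartAt_to_inv x)
  have h4 := (contMDiffAt_iff_contDiffAt.1 h3).differentiableAt (by simp)
  refine h4.congr_of_eventuallyEq ?_
  filter_upwards [extChartAt_target_mem_nhds (I := J) x] with z hz
  have hs : (extChartAt J x).symm z ∈ (chartAt H x).source := by
    rw [← extChartAt_source J]
    exact (extChartAt J x).map_target hz
  have h5 := TangentBundle.symmL_trivializationAt (I := J) (𝕜 := ℝ) hs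
  rw [(extChartAt J x).right_inv hz, J.range_eq_univ, mfderivWithin_univ] at h5
  ext w
  simp only [Function.comp_apply, ContinuousLinearMap.inCoordinates, oneFormInChart]
  rw [h5]
  simp

/-- A one-form on the model space as an alternating form. -/
abbrev alternatingOneForm (β : E →L[ℝ] ℝ) : E [⋀^Fin 1]→L[ℝ] ℝ :=
  ContinuousAlternatingMap.ofSubsingleton ℝ E ℝ (0 : Fin 1) β

theorem alternatingOneForm_comp {F : Type*} [NormedAddCommGroup F] [NormedSpace ℝ F]
    (β : E →L[ℝ] ℝ) (f : F →L[ℝ] E) :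
    (alternatingOneForm β).compContinuousLinearMap f = alternatingOneForm (β ∘L f) := by
  ext v
  simp [alternatingOneForm]

theorem differentiableAt_alternatingOneForm {β : E → E →L[ℝ] ℝ} {z : E}
    (h : DifferentiableAt ℝ β z) : DifferentiableAt ℝ (fun y ↦ alternatingOneForm (β y)) z :=
  (ContinuousAlternatingMap.ofSubsingletonLIE (𝕜 := ℝ) (E := E) (F := ℝ)
    (i := (0 : Fin 1))).differentiable.differentiableAt.comp z h

/-- Pullback of the exterior derivative of a one-form. -/
theorem extDeriv_alternatingOneForm_pullback {F : Type*} [NormedAddCommGroup F] [NormedSpace ℝ F]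
    {β : E → E →L[ℝ] ℝ} {f : F → E} {γ : F → F →L[ℝ] ℝ} {p : F}
    (hβ : DifferentiableAt ℝ β (f p)) (hf : ContDiffAt ℝ ∞ f p)
    (h : ∀ᶠ q in 𝓝 p, β (f q) ∘L fderiv ℝ f q = γ q) :
    (extDeriv (fun y ↦ alternatingOneForm (β y)) (f p)).compContinuousLinearMap (fderiv ℝ f p) =
      extDeriv (fun q ↦ alternatingOneForm (γ q)) p := by
  rw [← extDeriv_pullback (differentiableAt_alternatingOneForm hβ) hf
    (by simp only [minSmoothness_of_isRCLikeNormedField]; exact WithTop.coe_le_coe.2 le_top)]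
  have hev : (fun q ↦ (alternatingOneForm (β (f q))).compContinuousLinearMap (fderiv ℝ f q))
      =ᶠ[𝓝 p] fun q ↦ alternatingOneForm (γ q) := by
    filter_upwards [h] with q hq
    rw [alternatingOneForm_comp, hq]
  rw [extDeriv, extDeriv, hev.fderiv_eq]

/-- The derivative at `0` of the orbit map of `x`, read in the chart at `x`. -/
def orbitDeriv (J : ModelWithCorners ℝ E H) (act : T → M → M) (x : M) : T →L[ℝ] E :=
  fderiv ℝ (fun v ↦ chartAct J act x v (extChartAt J x x)) 0

namespace IsToralAction

variable {act : T → M → M} (ha : IsToralAction J act)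
include ha

theorem oneFormInChart_chartAct (hinv : ∀ v x w, α (act v x) (mfderiv J J (act v) x w) = α x w)
    {x : M} {v : T} {z : E} (h : (v, z) ∈ chartActDomain J act x) :
    oneFormInChart J α x (chartAct J act x v z) ∘L fderiv ℝ (chartAct J act x v) z =
      oneFormInChart J α x z := by
  have hsymm : ∀ y ∈ (extChartAt J x).target,
      MDifferentiableAt 𝓘(ℝ, E) J (extChartAt J x).symm y := fun y hy ↦
    ((contMDiffOn_extChartAt_symm (n := ∞) x).contMDiffAt
      ((isOpen_extChartAt_target x).mem_nhds hy)).mdifferentiableAt (by simp)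
  have hact : MDifferentiableAt J J (act v) ((extChartAt J x).symm z) :=
    (ha.smooth_act v).mdifferentiableAt (by simp)
  have hev : (extChartAt J x).symm ∘ chartAct J act x v =ᶠ[𝓝 z]
      act v ∘ (extChartAt J x).symm := by
    filter_upwards [ha.eventually_mem_chartActDomain_right h] with y hy using symm_chartAct hy
  have hchain : mfderiv 𝓘(ℝ, E) J ((extChartAt J x).symm ∘ chartAct J act x v) z =
      mfderiv 𝓘(ℝ, E) J (act v ∘ (extChartAt J x).symm) z := hev.mfderiv_eq
  rw [mfderiv_comp z (hsymm _ (chartAct_mem_target h))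
    (ha.differentiableAt_chartAct_right h).mdifferentiableAt,
    mfderiv_comp z hact (hsymm _ h.1), mfderiv_eq_fderiv] at hchain
  have hα : ∀ p q : M, p = q → (α p : E →L[ℝ] ℝ) = α q := by rintro p _ rfl; rfl
  ext w
  have hw := DFunLike.congr_fun hchain w
  have h1 := hinv v ((extChartAt J x).symm z) (mfderiv 𝓘(ℝ, E) J (extChartAt J x).symm z w)
  have h2 := hα _ _ (symm_chartAct h)
  refine Eq.trans ?_ h1
  exact (DFunLike.congr_fun h2 _).trans (congrArg (fun u : E ↦ (α _ : E →L[ℝ] ℝ) u) hw)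

/-- The orbit map satisfies `(v + w) • x = v • (w • x)`; differentiate in `w` at `0`. -/
theorem fderiv_orbit {x : M} {v : T} (h : (v, extChartAt J x x) ∈ chartActDomain J act x) :
    fderiv ℝ (fun v ↦ chartAct J act x v (extChartAt J x x)) v =
      fderiv ℝ (chartAct J act x v) (extChartAt J x x) ∘L orbitDeriv J act x := by
  set z₀ := extChartAt J x x
  have hz : chartAct J act x 0 z₀ = z₀ := ha.chartAct_zero (mem_extChartAt_target x)
  have hev : (fun w ↦ chartAct J act x (v + w) z₀) =ᶠ[𝓝 0]
      chartAct J act x v ∘ fun w ↦ chartAct J act x w z₀ := by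
    filter_upwards [ha.eventually_mem_chartActDomain_left (ha.zero_mem_chartActDomain x)] with w hw
      using ha.chartAct_add hw
  have h1 : fderiv ℝ (fun w ↦ chartAct J act x (v + w) z₀) 0 =
      fderiv ℝ (fun w ↦ chartAct J act x w z₀) v := by
    rw [fderiv_comp_add_left (f := fun w ↦ chartAct J act x w z₀), add_zero]
  rw [← h1, hev.fderiv_eq, fderiv_comp, hz]
  · rfl
  · rw [hz]
    exact ha.differentiableAt_chartAct_right h
  · exact (ha.contDiffAt_chartAct_left (ha.zero_mem_chartActDomain x)).differentiableAt (by simp)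

/-- By invariance, the pullback of `α` along the orbit map is the constant form `α x ∘ orbitDeriv`,
which is zero near `0`; `d` commutes with pullback. -/
theorem extDeriv_orbitDeriv_eq_zero (hα : IsSmoothOneForm J α)
    (hinv : ∀ v x w, α (act v x) (mfderiv J J (act v) x w) = α x w) {x : M}
    (hx : ∀ v, α x (orbitDeriv J act x v) = 0) :
    (extDeriv (fun y ↦ alternatingOneForm (oneFormInChart J α x y))
      (extChartAt J x x)).compContinuousLinearMap (orbitDeriv J act x) = 0 := by
  have hz : chartAct J act x 0 (extChartAt J x x) = extChartAt J x x :=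
    ha.chartAct_zero (mem_extChartAt_target x)
  have key := extDeriv_alternatingOneForm_pullback (β := oneFormInChart J α x)
    (f := fun v ↦ chartAct J act x v (extChartAt J x x)) (γ := fun _ : T ↦ 0) (p := 0)
    (by rw [hz]; exact differentiableAt_oneFormInChart hα x)
    (ha.contDiffAt_chartAct_left (ha.zero_mem_chartActDomain x))
    (by
      filter_upwards [ha.eventually_mem_chartActDomain_left (ha.zero_mem_chartActDomain x)]
        with v hv
      rw [ha.fderiv_orbit hv, ← ContinuousLinearMap.comp_assoc,
        ha.oneFormInChart_chartAct hinv hv, oneFormInChart_self]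
      ext w
      exact hx w)
  rw [hz] at key
  refine key.trans ?_
  rw [extDeriv, fderiv_fun_const]
  exact map_zero (ContinuousAlternatingMap.alternatizeUncurryFinCLM ℝ T ℝ)

theorem extDeriv_linAct (hα : IsSmoothOneForm J α)
    (hinv : ∀ v x w, α (act v x) (mfderiv J J (act v) x w) = α x w) {x : M} {v : T}
    (hv : act v x = x) :
    (extDeriv (fun y ↦ alternatingOneForm (oneFormInChart J α x y))
      (extChartAt J x x)).compContinuousLinearMap (linAct J act x v) =
    extDeriv (fun y ↦ alternatingOneForm (oneFormInChart J α x y)) (extChartAt J x x) := by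
  have hz := chartAct_of_fixed (J := J) hv
  have hmem := mem_chartActDomain_of_fixed (J := J) hv
  have key := extDeriv_alternatingOneForm_pullback (β := oneFormInChart J α x)
    (f := chartAct J act x v) (γ := oneFormInChart J α x) (p := extChartAt J x x)
    (by rw [hz]; exact differentiableAt_oneFormInChart hα x)
    (ha.contDiffAt_chartAct_right hmem)
    (by
      filter_upwards [ha.eventually_mem_chartActDomain_right hmem] with y hy
        using ha.oneFormInChart_chartAct hinv hy)
  rwa [hz] at key

theorem apply_linAct (hinv : ∀ v x w, α (act v x) (mfderiv J J (act v) x w) = α x w) {x : M}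
    {v : T} (hv : act v x = x) (w : E) : α x (linAct J act x v w) = α x w := by
  have h := ha.oneFormInChart_chartAct hinv (mem_chartActDomain_of_fixed (J := J) hv)
  rw [chartAct_of_fixed hv, oneFormInChart_self] at h
  exact DFunLike.congr_fun h w

/-- The kernel of the infinitesimal action at `x` fixes `x`. -/
theorem act_eq_of_orbitDeriv_eq_zero {x : M} {A : T} (hA : orbitDeriv J act x A = 0) :
    act A x = x := by
  set z₀ := extChartAt J x x with hz₀
  have hz : chartAct J act x 0 z₀ = z₀ := ha.chartAct_zero (mem_extChartAt_target x)
  have hc : ContinuousAt (fun s : ℝ ↦ s • A) 0 := by fun_prop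
  have hev : ∀ᶠ s : ℝ in 𝓝 0, (s • A, z₀) ∈ chartActDomain J act x := by
    refine hc.eventually (p := fun v ↦ (v, z₀) ∈ chartActDomain J act x) ?_
    change ∀ᶠ v in 𝓝 ((0 : ℝ) • A), (v, z₀) ∈ chartActDomain J act x
    rw [zero_smul]
    exact ha.eventually_mem_chartActDomain_left (ha.zero_mem_chartActDomain x)
  obtain ⟨r, hr, hball⟩ := Metric.eventually_nhds_iff_ball.1 hev
  have hderiv : ∀ s ∈ Metric.ball (0 : ℝ) r,
      HasDerivAt (fun s : ℝ ↦ chartAct J act x (s • A) z₀) 0 s := by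
    intro s hs
    have h1 := ((ha.contDiffAt_chartAct_left (hball s hs)).differentiableAt
      (by simp)).hasFDerivAt
    have h2 : HasDerivAt (fun s : ℝ ↦ s • A) A s := by
      simpa using (hasDerivAt_id s).smul_const A
    have h3 := h1.comp_hasDerivAt s h2
    rw [ha.fderiv_orbit (hball s hs), ContinuousLinearMap.comp_apply, hA, map_zero] at h3
    exact h3
  have hconst : ∀ s ∈ Metric.ball (0 : ℝ) r, act (s • A) x = x := by
    intro s hs
    have h1 := (convex_ball (0 : ℝ) r).norm_image_sub_le_of_norm_hasDerivWithin_le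
      (C := 0) (fun s hs ↦ (hderiv s hs).hasDerivWithinAt) (by simp)
      (Metric.mem_ball_self hr) hs
    rw [zero_mul, zero_smul, hz] at h1
    have h2 : chartAct J act x (s • A) z₀ = z₀ := sub_eq_zero.1 (norm_le_zero_iff.1 h1)
    have h3 := symm_chartAct (hball s hs)
    rw [h2, hz₀, extChartAt_to_inv] at h3
    exact h3.symm
  -- The chart only shows that `s • A` fixes `x` for small `s`; `A` is a multiple of such an
  -- element.
  obtain ⟨n, hn⟩ := exists_nat_one_div_lt hr
  have h1 := ha.act_nsmul_of_fixed (hconst (1 / ((n : ℝ) + 1)) (by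
    rw [Metric.mem_ball, dist_zero_right, Real.norm_of_nonneg (by positivity)]
    exact hn)) (n + 1)
  have h2 : (n + 1) • (1 / ((n : ℝ) + 1)) • A = A := by
    rw [← Nat.cast_smul_eq_nsmul ℝ, smul_smul, Nat.cast_add, Nat.cast_one,
      mul_one_div_cancel (by positivity), one_smul]
  rwa [h2] at h1

/-- As `T` is commutative, an element fixing `x` fixes its whole orbit, so its derivative fixes the
tangent vectors of the orbit. -/
theorem linAct_comp_orbitDeriv {x : M} {v : T} (hv : act v x = x) :
    linAct J act x v ∘L orbitDeriv J act x = orbitDeriv J act x := by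
  rw [linAct, ← ha.fderiv_orbit (mem_chartActDomain_of_fixed hv)]
  have h1 : (fun w ↦ chartAct J act x (v + w) (extChartAt J x x)) =
      fun w ↦ chartAct J act x w (extChartAt J x x) := by
    ext w
    rw [add_comm, ha.chartAct_add (mem_chartActDomain_of_fixed hv), chartAct_of_fixed hv]
  have h2 := fderiv_comp_add_left (𝕜 := ℝ) (x := 0)
    (f := fun w ↦ chartAct J act x w (extChartAt J x x)) v
  rw [h1, add_zero] at h2
  exact h2.symm

end IsToralAction

end InvariantForms

/-! ### Infinitesimal isotropy and the dimension bound -/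

section Isotropy

open Filter Topology

variable {T : Type*} [NormedAddCommGroup T] [NormedSpace ℝ T]
  {E : Type*} [NormedAddCommGroup E] [NormedSpace ℝ E]
  {H : Type*} [TopologicalSpace H] {J : ModelWithCorners ℝ E H}
  {M : Type*} [TopologicalSpace M] [ChartedSpace H M] [IsManifold J ∞ M]
  {α : ∀ x : M, TangentSpace J x →L[ℝ] ℝ}

theorem dOneForm_eq_extDeriv (α : ∀ x : M, TangentSpace J x →L[ℝ] ℝ) (x : M) :
    dOneForm J α x = extDeriv (fun y ↦ alternatingOneForm (oneFormInChart J α x y))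
      (extChartAt J x x) := by
  have : IsManifold J 1 M := .of_le (n := ∞) (by simp)
  rw [dOneForm, mfderiv_extChartAt_self]
  rfl

/-- If `η` is invariant under a one-parameter group, its generator is skew for `η`. -/
theorem generator_skew {ρ : ℝ → E →L[ℝ] E} {X : E →L[ℝ] E}
    (hadd : ∀ s t, ρ (s + t) = ρ s ∘L ρ t) (h0 : ρ 0 = ContinuousLinearMap.id ℝ E)
    (hX : HasDerivAt ρ X 0) (η : E [⋀^Fin 2]→L[ℝ] ℝ)
    (hη : ∀ t, η.compContinuousLinearMap (ρ t) = η) (v w : E) :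
    η ![X v, w] + η ![v, X w] = 0 := by
  have hinv : ∀ t a b, η ![ρ t a, ρ t b] = η ![a, b] := by
    intro t a b
    have h := DFunLike.congr_fun (hη t) ![a, b]
    rw [← h, ContinuousAlternatingMap.compContinuousLinearMap_apply]
    congr 1
    ext i
    fin_cases i <;> rfl
  -- With `ρ` moved to the other slot, each side varies in a single argument, and differentiating at
  -- `0` gives skewness.
  have hmove : ∀ t, η ![ρ t v, w] = η ![v, ρ (-t) w] := by
    intro t
    rw [← hinv t v, ← ContinuousLinearMap.comp_apply, ← hadd, add_neg_cancel, h0,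
      ContinuousLinearMap.id_apply]
  let L₁ : E →L[ℝ] ℝ := η.toContinuousMultilinearMap.toContinuousLinearMap ![0, w] 0
  let L₂ : E →L[ℝ] ℝ := η.toContinuousMultilinearMap.toContinuousLinearMap ![v, 0] 1
  have hL₁ : ∀ a, L₁ a = η ![a, w] := by
    intro a
    change η (Function.update ![0, w] 0 a) = _
    congr 1
    ext i
    fin_cases i <;> rfl
  have hL₂ : ∀ a, L₂ a = η ![v, a] := by
    intro a
    change η (Function.update ![v, 0] 1 a) = _
    congr 1
    ext i
    fin_cases i <;> rfl
  have hd : ∀ a, HasDerivAt (fun t ↦ ρ t a) (X a) 0 := by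
    intro a
    have := hX.clm_apply (hasDerivAt_const (0 : ℝ) a)
    simpa using this
  have h1 : HasDerivAt (fun t ↦ L₁ (ρ t v)) (L₁ (X v)) 0 :=
    L₁.hasFDerivAt.comp_hasDerivAt 0 (hd v)
  have h2 : HasDerivAt (fun t ↦ L₂ (ρ t w)) (L₂ (X w)) (-0) := by
    rw [neg_zero]
    exact L₂.hasFDerivAt.comp_hasDerivAt 0 (hd w)
  have h3 : HasDerivAt (fun t ↦ L₂ (ρ (-t) w)) (-L₂ (X w)) 0 := by
    have := h2.scomp 0 (hasDerivAt_neg (0 : ℝ))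
    simpa using! this
  have h4 : (fun t ↦ L₁ (ρ t v)) = fun t ↦ L₂ (ρ (-t) w) := by
    ext t
    rw [hL₁, hL₂, hmove]
  rw [h4] at h1
  have h5 := h1.unique h3
  rw [hL₁, hL₂] at h5
  linarith

namespace IsToralAction

variable [J.Boundaryless] {act : T → M → M} (ha : IsToralAction J act)
include ha

theorem hasDerivAt_linAct (x : M) (A : T) :
    HasDerivAt (fun t : ℝ ↦ linAct J act x (t • A)) (fderiv ℝ (linAct J act x) 0 A) 0 := by
  have h1 : HasFDerivAt (linAct J act x) (fderiv ℝ (linAct J act x) 0) ((0 : ℝ) • A) := by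
    rw [zero_smul]
    exact ((ha.contDiffAt_linAct (ha.zero x)).differentiableAt (by simp)).hasFDerivAt
  have h2 : HasDerivAt (fun s : ℝ ↦ s • A) A 0 := by
    simpa using (hasDerivAt_id (0 : ℝ)).smul_const A
  exact h1.comp_hasDerivAt 0 h2

/-- If a contact form is invariant under a locally effective toral action and some orbit is
tangent to its kernel, then the group has dimension at most `n`. -/
theorem finrank_le_of_orbit_tangent [FiniteDimensional ℝ T] [FiniteDimensional ℝ E]
    [T2Space M] [ConnectedSpace M] (hα : IsSmoothOneForm J α) {n : ℕ}
    (hn : Module.finrank ℝ E = 2 * n + 1) {x : M}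
    (hcontact : wedge (AlternatingMap.ofSubsingleton ℝ (TangentSpace J x) ℝ (0 : Fin 1)
        (α x).toLinearMap) (wedgePow (dOneForm J α x).toAlternatingMap n) ≠ 0)
    (hinv : ∀ v x w, α (act v x) (mfderiv J J (act v) x w) = α x w)
    (hfaith : ∀ A, (∀ (t : ℝ) p, act (t • A) p = p) → A = 0)
    (hx : ∀ v, α x (orbitDeriv J act x v) = 0) : Module.finrank ℝ T ≤ n := by
  let D := (orbitDeriv J act x).toLinearMap
  let X₀ : T →L[ℝ] E →L[ℝ] E := fderiv ℝ (linAct J act x) 0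
  have hD : ∀ (A : LinearMap.ker D) (t : ℝ), act (t • (A : T)) x = x := fun A t ↦
    ha.act_eq_of_orbitDeriv_eq_zero <| by
      have : orbitDeriv J act x A = 0 := A.2
      rw [map_smul, this, smul_zero]
  have hadd : ∀ (A : LinearMap.ker D) (s t : ℝ), linAct J act x ((s + t) • (A : T)) =
      linAct J act x (s • (A : T)) ∘L linAct J act x (t • (A : T)) := by
    intro A s t
    rw [add_smul, ha.linAct_add (hD A s) (hD A t)]
  have hzero : ∀ A : T, linAct J act x ((0 : ℝ) • A) = ContinuousLinearMap.id ℝ E := by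
    intro A
    rw [zero_smul, ha.linAct_zero]
  have hder := ha.hasDerivAt_linAct x
  have hcommρ : ∀ (A B : LinearMap.ker D) (s t : ℝ),
      linAct J act x (s • (A : T)) ∘L linAct J act x (t • (B : T)) =
      linAct J act x (t • (B : T)) ∘L linAct J act x (s • (A : T)) := by
    intro A B s t
    rw [← ha.linAct_add (hD A s) (hD B t), ← ha.linAct_add (hD B t) (hD A s), add_comm]
  have hderL : ∀ (A : T) (C : E →L[ℝ] E),
      HasDerivAt (fun t : ℝ ↦ C ∘L linAct J act x (t • A)) (C ∘L X₀ A) 0 := fun A C ↦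
    (ContinuousLinearMap.compL ℝ E E E C).hasFDerivAt.comp_hasDerivAt _ (hder A)
  have hderR : ∀ (A : T) (C : E →L[ℝ] E),
      HasDerivAt (fun t : ℝ ↦ linAct J act x (t • A) ∘L C) (X₀ A ∘L C) 0 := fun A C ↦
    ((ContinuousLinearMap.compL ℝ E E E).flip C).hasFDerivAt.comp_hasDerivAt _ (hder A)
  -- Differentiate the commutation of the two one-parameter groups at `0`, one parameter at a time.
  have hcommX : ∀ A B : LinearMap.ker D, X₀ A ∘L X₀ B = X₀ B ∘L X₀ A := by
    intro A B
    have h1 : ∀ t : ℝ, X₀ A ∘L linAct J act x (t • (B : T)) =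
        linAct J act x (t • (B : T)) ∘L X₀ A := by
      intro t
      have h2 := hderR A (linAct J act x (t • (B : T)))
      have h3 := hderL A (linAct J act x (t • (B : T)))
      simp only [hcommρ A B _ t] at h2
      exact h2.unique h3
    have h2 := hderL B (X₀ A)
    simp only [h1] at h2
    exact h2.unique (hderR B (X₀ A))
  let X : LinearMap.ker D →ₗ[ℝ] E →ₗ[ℝ] E :=
    ContinuousLinearMap.coeLM ℝ ∘ₗ X₀.toLinearMap ∘ₗ (LinearMap.ker D).subtype
  have hX : ∀ A v, X A v = X₀ A v := fun _ _ ↦ rfl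
  rw [dOneForm_eq_extDeriv] at hcontact
  obtain ⟨C, hC⟩ := ha.exists_bound_linAct x
  refine finrank_le_of_isotropy hn (α x).toLinearMap
    (extDeriv (fun y ↦ alternatingOneForm (oneFormInChart J α x y))
      (extChartAt J x x)).toAlternatingMap hcontact D hx ?_ X ?_ ?_ ?_ ?_ ?_ ?_
  · intro v w
    have h := DFunLike.congr_fun (ha.extDeriv_orbitDeriv_eq_zero hα hinv hx) ![v, w]
    refine Eq.trans ?_ h
    rw [ContinuousAlternatingMap.compContinuousLinearMap_apply]
    change extDeriv _ _ _ = extDeriv _ _ _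
    congr 1
    ext i
    fin_cases i <;> rfl
  · intro A B v
    exact DFunLike.congr_fun (hcommX A B) v
  · intro A v h
    exact generator_apply_eq_zero_of_bounded (hadd A) (hzero A) (hder A)
      (fun t ↦ hC _ (hD A t)) h
  · intro A hA
    have hA0 : X₀ A = 0 := by
      ext v
      exact LinearMap.congr_fun hA v
    have h1 := hder A
    rw [show fderiv ℝ (linAct J act x) 0 (A : T) = 0 from hA0] at h1
    have h2 := eq_id_of_hasDerivAt_zero (hadd A) (hzero A) h1
    -- A vanishing generator makes the whole line `ℝ A` act with identity derivative at `x`; the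
    -- line is closed under doubling, so rigidity applies.
    have h3 := ha.fixed_of_linAct_eq_id (S := Set.range fun t : ℝ ↦ t • (A : T))
      (by
        rintro _ ⟨t, rfl⟩
        exact ⟨t + t, add_smul _ _ _⟩)
      (by
        rintro _ ⟨t, rfl⟩
        exact hD A t)
      (by
        rintro _ ⟨t, rfl⟩
        exact h2 t)
    exact Subtype.ext (hfaith A fun t p ↦ h3 _ ⟨t, rfl⟩ p)
  · intro A v
    have h1 : HasDerivAt (fun t : ℝ ↦ linAct J act x (t • (A : T)) v) (X₀ A v) 0 := by
      have := (hder A).clm_apply (hasDerivAt_const (0 : ℝ) v)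
      simpa using this
    let a : E →L[ℝ] ℝ := α x
    have h2 : HasDerivAt (fun t : ℝ ↦ a (linAct J act x (t • (A : T)) v)) (a (X₀ A v)) 0 :=
      a.hasFDerivAt.comp_hasDerivAt 0 h1
    have h3 : (fun t : ℝ ↦ a (linAct J act x (t • (A : T)) v)) = fun _ ↦ a v := by
      ext t
      exact ha.apply_linAct hinv (hD A t) v
    rw [h3] at h2
    exact h2.unique (hasDerivAt_const _ _)
  · intro A v w
    exact generator_skew (hadd A) (hzero A) (hder A) _
      (fun t ↦ ha.extDeriv_linAct hα hinv (hD A t)) v w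
  · intro A v
    have h1 : HasDerivAt (fun t : ℝ ↦ linAct J act x (t • (A : T)) (orbitDeriv J act x v))
        (X₀ A (orbitDeriv J act x v)) 0 := by
      have := (hder A).clm_apply (hasDerivAt_const (0 : ℝ) (orbitDeriv J act x v))
      simpa using this
    have h3 : (fun t : ℝ ↦ linAct J act x (t • (A : T)) (orbitDeriv J act x v)) =
        fun _ ↦ orbitDeriv J act x v := by
      ext t
      exact DFunLike.congr_fun (ha.linAct_comp_orbitDeriv (hD A t)) v
    rw [h3] at h1
    exact h1.unique (hasDerivAt_const _ _)

end IsToralAction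

end Isotropy

/-! ### Passing from the torus to its universal cover -/

section Torus

open Filter Topology

/-- The exponential map of the standard torus. -/
def torusExp (k : ℕ) (v : Fin k → ℝ) : Fin k → Circle := fun i ↦ Circle.exp (v i)

theorem contMDiff_torusExp (k : ℕ) :
    ContMDiff 𝓘(ℝ, Fin k → ℝ) (ModelWithCorners.pi fun _ : Fin k ↦ 𝓡 1) ∞ (torusExp k) := by
  intro v
  rw [contMDiffAt_iff]
  refine ⟨?_, ?_⟩
  · exact (continuous_pi fun i ↦ Circle.exp.continuous.comp (continuous_apply i)).continuousAt
  · rw [contDiffWithinAt_pi]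
    intro i
    have h1 : ContMDiffAt 𝓘(ℝ, Fin k → ℝ) (𝓡 1) ∞ (fun w : Fin k → ℝ ↦ Circle.exp (w i)) v :=
      ContMDiff.contMDiffAt (contMDiff_circleExp.comp
        (contMDiff_iff_contDiff.2 (contDiff_apply ℝ ℝ i)))
    exact (contMDiffAt_iff.1 h1).2

theorem torusExp_zero (k : ℕ) : torusExp k 0 = 1 := by
  ext i
  simp [torusExp]

theorem torusExp_add (k : ℕ) (v w : Fin k → ℝ) :
    torusExp k (v + w) = torusExp k v * torusExp k w := by
  funext i
  simp [torusExp, Circle.exp_add]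

theorem exists_mem_Icc_torusExp_eq (k : ℕ) (v : Fin k → ℝ) :
    ∃ q ∈ Set.Icc (fun _ : Fin k ↦ -Real.pi) (fun _ ↦ Real.pi), torusExp k q = torusExp k v := by
  refine ⟨fun i ↦ Complex.arg (Circle.exp (v i)), ⟨fun i ↦ ?_, fun i ↦ ?_⟩, ?_⟩
  · exact (Complex.neg_pi_lt_arg _).le
  · exact Complex.arg_le_pi _
  · funext i
    exact Circle.exp_arg _

theorem eq_zero_of_torusExp_smul {k : ℕ} {A : Fin k → ℝ} (h : ∀ t : ℝ, torusExp k (t • A) = 1) :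
    A = 0 := by
  funext i
  by_contra hne
  have hne : A i ≠ 0 := hne
  have h1 : Circle.exp ((Real.pi / A i) * A i) = 1 := congrFun (h (Real.pi / A i)) i
  rw [div_mul_cancel₀ _ hne] at h1
  exact Circle.exp_pi_ne_one h1

variable {F : Type*} [NormedAddCommGroup F] [NormedSpace ℝ F]
  {K : Type*} [TopologicalSpace K] {I : ModelWithCorners ℝ F K}
  {E : Type*} [NormedAddCommGroup E] [NormedSpace ℝ E]
  {H : Type*} [TopologicalSpace H] {J : ModelWithCorners ℝ E H}
  {G : Type*} [Group G] {M : Type*} [MulAction G M] {k : ℕ} (e : G ≃* (Fin k → Circle))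

/-- The action of the universal cover `ℝᵏ` of a torus. -/
def coverAct (M : Type*) [MulAction G M] (v : Fin k → ℝ) (p : M) : M :=
  e.symm (torusExp k v) • p

theorem eq_zero_of_coverAct_trivial [FaithfulSMul G M] {A : Fin k → ℝ}
    (h : ∀ (t : ℝ) (p : M), coverAct e M (t • A) p = p) : A = 0 := by
  refine eq_zero_of_torusExp_smul fun t ↦ ?_
  have h1 : e.symm (torusExp k (t • A)) = 1 :=
    eq_of_smul_eq_smul (α := M) fun p ↦ by rw [one_smul]; exact h t p
  simpa using h1

variable [TopologicalSpace G] [ChartedSpace K G]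

/-- The derivative of `e` at `1` has a left inverse. Only this inequality is needed, since `k` is
bounded above by `n`. -/
theorem finrank_le_of_torus_equiv
    (he : ContMDiff I (ModelWithCorners.pi fun _ : Fin k ↦ 𝓡 1) ∞ e)
    (hes : ContMDiff (ModelWithCorners.pi fun _ : Fin k ↦ 𝓡 1) I ∞ e.symm) :
    Module.finrank ℝ F ≤ k := by
  have h1 : MDifferentiableAt I (ModelWithCorners.pi fun _ : Fin k ↦ 𝓡 1) e 1 :=
    he.mdifferentiableAt (by simp)
  have h2 : MDifferentiableAt (ModelWithCorners.pi fun _ : Fin k ↦ 𝓡 1) I e.symm (e 1) :=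
    hes.mdifferentiableAt (by simp)
  have h3 := mfderiv_comp 1 h2 h1
  have h4 : (e.symm ∘ e : G → G) = id := by
    ext g
    simp
  rw [h4, mfderiv_id] at h3
  let d : F →L[ℝ] (Fin k → EuclideanSpace ℝ (Fin 1)) :=
    mfderiv I (ModelWithCorners.pi fun _ : Fin k ↦ 𝓡 1) e 1
  have hinj : Function.Injective d := by
    refine Function.LeftInverse.injective
      (g := (mfderiv (ModelWithCorners.pi fun _ : Fin k ↦ 𝓡 1) I e.symm (e 1) :
        (Fin k → EuclideanSpace ℝ (Fin 1)) →L[ℝ] F)) fun v ↦ ?_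
    exact (DFunLike.congr_fun h3 v).symm
  have := LinearMap.finrank_le_finrank_of_injective (f := d.toLinearMap) hinj
  simpa [Module.finrank_pi_fintype] using this

variable [TopologicalSpace M] [ChartedSpace H M]

theorem isToralAction_coverAct [ContMDiffSMul I J ∞ G M]
    (hes : ContMDiff (ModelWithCorners.pi fun _ : Fin k ↦ 𝓡 1) I ∞ e.symm) :
    IsToralAction J (coverAct e M) where
  smooth := (contMDiff_smul (I := I) (G := G)).comp
    (((hes.comp (contMDiff_torusExp k)).comp contMDiff_fst).prodMk contMDiff_snd)
  zero p := by simp [coverAct, torusExp_zero]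
  add v w p := by simp [coverAct, torusExp_add, mul_smul]
  compact := by
    refine ⟨Set.Icc (fun _ ↦ -Real.pi) (fun _ ↦ Real.pi), isCompact_Icc, fun v ↦ ?_⟩
    obtain ⟨q, hq, hqv⟩ := exists_mem_Icc_torusExp_eq k v
    exact ⟨q, hq, by ext p; simp [coverAct, hqv]⟩

/-- Transfers the vanishing of the moment map to the cover: `A` is the image of `v` under the
derivative of `e.symm ∘ torusExp k` at `0`. -/
theorem orbitDeriv_coverAct_eq_inducedVector [IsManifold J ∞ M] [ContMDiffSMul I J ∞ G M]
    (hes : ContMDiff (ModelWithCorners.pi fun _ : Fin k ↦ 𝓡 1) I ∞ e.symm) (x : M)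
    (v : Fin k → ℝ) :
    ∃ A : GroupLieAlgebra I G, orbitDeriv J (coverAct e M) x v = inducedVector I J G x A := by
  have : IsManifold J 1 M := .of_le (n := ∞) (by simp)
  have hs : ContMDiff 𝓘(ℝ, Fin k → ℝ) I ∞ (e.symm ∘ torusExp k) :=
    hes.comp (contMDiff_torusExp k)
  have h0 : (e.symm ∘ torusExp k) 0 = 1 := by simp [torusExp_zero]
  have hg : ContMDiff I J ∞ (fun g : G ↦ g • x) :=
    (contMDiff_smul (I := I) (G := G)).comp (contMDiff_id.prodMk contMDiff_const)
  have h1 := (hs.mdifferentiableAt (x := 0) (by simp)).hasMFDerivAt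
  have h2 : HasMFDerivAt I J (fun g : G ↦ g • x) ((e.symm ∘ torusExp k) 0)
      (mfderiv I J (fun g : G ↦ g • x) ((e.symm ∘ torusExp k) 0)) :=
    (hg.mdifferentiableAt (by simp)).hasMFDerivAt
  have hpt : ∀ p : M, p = x → HasMFDerivAt J 𝓘(ℝ, E) (extChartAt J x) p
      (ContinuousLinearMap.id ℝ E : E →L[ℝ] E) := by
    rintro p rfl
    have := (mdifferentiableAt_extChartAt (I := J) (mem_chart_source H p)).hasMFDerivAt
    rwa [mfderiv_extChartAt_self] at this
  have hx : (fun g : G ↦ g • x) ((e.symm ∘ torusExp k) 0) = x := by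
    simp [torusExp_zero]
  let d₁ : (Fin k → ℝ) →L[ℝ] F := mfderiv 𝓘(ℝ, Fin k → ℝ) I (e.symm ∘ torusExp k) 0
  let d₂ : F →L[ℝ] E := mfderiv I J (fun g : G ↦ g • x) ((e.symm ∘ torusExp k) 0)
  have hcomp : HasFDerivAt (extChartAt J x ∘ (fun g : G ↦ g • x) ∘ e.symm ∘ torusExp k)
      (ContinuousLinearMap.id ℝ E ∘L d₂ ∘L d₁) 0 := ((hpt _ hx).comp 0 (h2.comp 0 h1)).hasFDerivAt
  have hfun : (fun v ↦ chartAct J (coverAct e M) x v (extChartAt J x x)) =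
      extChartAt J x ∘ (fun g : G ↦ g • x) ∘ e.symm ∘ torusExp k := by
    ext w
    simp [chartAct, coverAct]
  have hd : ∀ g : G, g = 1 → (mfderiv I J (fun g : G ↦ g • x) g : F →L[ℝ] E) =
      mfderiv I J (fun g : G ↦ g • x) (1 : G) := by
    rintro _ rfl
    rfl
  refine ⟨d₁ v, ?_⟩
  rw [orbitDeriv, hfun, hcomp.fderiv]
  exact DFunLike.congr_fun (hd ((e.symm ∘ torusExp k) 0) h0) (d₁ v)

end Torus

end ContactTorus

end

theorem mainTheorem3
    {F : Type*} [NormedAddCommGroup F] [NormedSpace ℝ F] [FiniteDimensional ℝ F]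
    {K : Type*} [TopologicalSpace K] (I : ModelWithCorners ℝ F K) [I.Boundaryless]
    {E : Type*} [NormedAddCommGroup E] [NormedSpace ℝ E] [FiniteDimensional ℝ E]
    {H : Type*} [TopologicalSpace H] (J : ModelWithCorners ℝ E H) [J.Boundaryless]
    (G : Type*) [TopologicalSpace G] [ChartedSpace K G] [Group G] [LieGroup I ∞ G]
    (hG : ContactTorus.IsTorus I G)
    (M : Type*) [TopologicalSpace M] [ChartedSpace H M] [IsManifold J ∞ M]
    [T2Space M] [ConnectedSpace M]
    [MulAction G M] [ContMDiffSMul I J ∞ G M] [FaithfulSMul G M]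
    (α : ∀ x : M, TangentSpace J x →L[ℝ] ℝ)
    (hα : ContactTorus.IsContactForm J α)
    (hinv : ContactTorus.IsInvariantOneForm J G α)
    (hdim : Module.finrank ℝ E + 1 = 2 * Module.finrank ℝ F)
    (x : M) :
    ContactTorus.momentMap I J G α x ≠ 0 := by
  intro hx
  obtain ⟨k, e, he, hes⟩ := hG
  obtain ⟨hsmooth, n, hn, hcontact⟩ := hα
  have hk := ContactTorus.finrank_le_of_torus_equiv e he hes
  have hact := ContactTorus.isToralAction_coverAct (J := J) (M := M) e hes
  have hle := hact.finrank_le_of_orbit_tangent hsmooth hn (hcontact x)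
    (fun v p w ↦ hinv (e.symm (ContactTorus.torusExp k v)) p w)
    (fun A hA ↦ ContactTorus.eq_zero_of_coverAct_trivial e hA)
    (fun v ↦ by
      obtain ⟨A, hA⟩ := ContactTorus.orbitDeriv_coverAct_eq_inducedVector (J := J) e hes x v
      rw [hA]
      exact LinearMap.congr_fun hx A)
  rw [Module.finrank_fin_fun] at hle
  -- `2n + 2 = 2 dim G` gives `dim G = n + 1`, against `dim G ≤ k ≤ n`.
  omega
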